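/- Let $\varphi:(0,\infty)\to[0,\infty)$ and $f:(0,\infty)\to(0,\infty)$ be continuous functions such that (i) $\liminf_{t\searrow 0} f(t)>0$ (the value $+\infty$ is allowed); (ii) $\int_0^1 r\varphi(r)\,dr=\infty$. Let $N\ge 2$, let $\Omega\subset\mathbb{R}^N$ be a bounded domain (nonempty, open, connected) with $C^2$ boundary, let $\delta_\Omega(x)=\operatorname{dist}(x,\partial\Omega)$, and let $r_0>0$ be arbitrary. Then there is no positive function $u$ of class $C^2$ on the exterior collar $\{x\in\mathbb{R}^N\setminus\overline\Omega : 0<\delta_\Omega(x)<2r_0\}$ that satisfies $$-\Delta u\ \ge\ \varphi(\delta_\Omega(x))\,f(u)\qquad\text{in } \{x\in\mathbb{R}^N\setminus\overline\Omega : 0<\delta_\Omega(x)<2r_0\}.$$ Here $\Omega$ has $C^2$ boundary if every $x\in\partial\Omega$ has a neighbourhood $U$ and a $C^2$ function $g:U\to\mathbb{R}$ with $\nabla g(x)\ne 0$ and $\Omega\cap U=\{y\in U: g(y)<0\}$. -/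

import Mathlib

open scoped Topology

/-- `Ω` has `C²` boundary, with `Ω` locally on one side of it: near every boundary point `x`, the
set `Ω` is the sublevel set `{g < 0}` of a function `g` that is `C²` near `x` and has nonzero
differential at `x`. -/
def HasC2Boundary {N : ℕ} (Ω : Set (EuclideanSpace ℝ (Fin N))) : Prop :=
  ∀ x ∈ frontier Ω, ∃ g : EuclideanSpace ℝ (Fin N) → ℝ,
    ContDiffAt ℝ 2 g x ∧ fderiv ℝ g x ≠ 0 ∧ ∀ᶠ y in 𝓝 x, (y ∈ Ω ↔ g y < 0)

/-- A bounded domain (nonempty connected open set) with `C²` boundary. -/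
structure IsBoundedC2Domain {N : ℕ} (Ω : Set (EuclideanSpace ℝ (Fin N))) : Prop where
  isOpen : IsOpen Ω
  isConnected : IsConnected Ω
  isBounded : Bornology.IsBounded Ω
  hasC2Boundary : HasC2Boundary Ω

/-- The distance `δ_Ω(x) = dist(x, ∂Ω)` to the boundary of `Ω`. -/
noncomputable def boundaryDist {N : ℕ} (Ω : Set (EuclideanSpace ℝ (Fin N)))
    (x : EuclideanSpace ℝ (Fin N)) : ℝ :=
  Metric.infDist x (frontier Ω)

/-- The exterior collar `{x ∈ ℝᴺ \ closure Ω : 0 < δ_Ω(x) < s}`. -/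
def exteriorCollar {N : ℕ} (Ω : Set (EuclideanSpace ℝ (Fin N))) (s : ℝ) :
    Set (EuclideanSpace ℝ (Fin N)) :=
  {x | x ∉ closure Ω ∧ 0 < boundaryDist Ω x ∧ boundaryDist Ω x < s}

/-- `u` is a `C²` positive solution of `-Δu ≥ φ(δ_Ω(x)) f(u)` in the set `S`. -/
structure IsC2PositiveSolution {N : ℕ} (φ f : ℝ → ℝ) (Ω S : Set (EuclideanSpace ℝ (Fin N)))
    (u : EuclideanSpace ℝ (Fin N) → ℝ) : Prop where
  contDiffOn : ContDiffOn ℝ 2 u S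
  pos : ∀ x ∈ S, 0 < u x
  ineq : ∀ x ∈ S, φ (boundaryDist Ω x) * f (u x) ≤ -(Laplacian.laplacian u x)

/-!
The proof is by comparison, near one boundary point `p`, with functions of the boundary distance
`δ = boundaryDist Ω`.

In one dimension, `W' = λ e^{K r} ∫_r^R φ`, `W ε = 0` defines an increasing solution of
`-W'' + K W' = λ e^{K r} φ` on `(ε, R)`. Normalize it by `W R = M`. Since `∫_0 r φ(r) dr` diverges,
`ε → 0` forces `λ → 0` and `W r → M` at every fixed `r > 0`. So there are subsolutions for `c φ`,
with `c` as small as one likes, that vanish at `ε`, never exceed `M` and are at least `3 M / 4` at a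
prescribed point (`exists_barrier`). The bound `W ≤ M` makes the argument independent of `f` near
infinity: only `f ≥ c` on `(0, M]` is needed, which follows from the lower limit at `0`.

Such a `W` does not come back to `0` at `R`. This is compensated by a superharmonic function `A H`,
where `H ≥ 0` outside `Ω`, with equality at `p` only; it exists at a point `p` where a ball inside `Ω` touches `∂Ω`
(`exists_superharmonic_barrier`), for instance a boundary point nearest to an interior point.

Given a solution `u`, take `q` so close to `p` that `H q` is small, `M = 4 u(q)`, and `A` such that
`A H ≥ M` at distance `R` from `p`. Then `F = u - W(δ) + A H` is negative at `q` but positive where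
`δ = ε` or `|x - p| = R`, so it has a negative interior minimum `x`, at which `u(x) < M`. There `δ`
need not be treated as a `C²` function: as `W` is increasing, `δ` may be replaced by any smaller
function agreeing with it at `x`. The `C²` boundary has exterior balls of uniform radius `ρ` near
`p` (`exists_uniform_exterior_ball`), and the distance to the sphere of the one at the boundary
point nearest to `x` is such a function, with Laplacian at least `-2 N / ρ`. Hence
`0 ≤ -c φ + (-W'' + K W') + A ΔH < 0` at `x` with `K = 2 N / ρ`, a contradiction
(`laplacian_ge_of_isLocalMin_sub_comp_boundaryDist`).
-/

/-! ### The Laplacian of radial functions and at a local minimum -/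

/-- The necessary second-order condition: if the second derivative were negative, the point would
also be a local maximum, hence the function locally constant. -/
lemma IsLocalMin.deriv_deriv_nonneg {f : ℝ → ℝ} {a : ℝ} (hf : IsLocalMin f a)
    (hc : ContinuousAt f a) : 0 ≤ deriv (deriv f) a := by
  by_contra! h
  have hmax := isLocalMax_of_deriv_deriv_neg h hf.deriv_eq_zero hc
  have hconst : f =ᶠ[𝓝 a] fun _ => f a := by
    filter_upwards [hf, hmax] with x h1 h2 using le_antisymm h2 h1
  have h0 : deriv (deriv f) a = 0 := by
    rw [hconst.deriv.deriv_eq]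
    simp
  exact h.ne h0

section Laplacian

variable {E : Type*} [NormedAddCommGroup E] [InnerProductSpace ℝ E]

lemma ContDiffAt.deriv_deriv_line {F : E → ℝ} {x : E} (hF : ContDiffAt ℝ 2 F x) (e : E) :
    deriv (deriv fun t : ℝ => F (x + t • e)) 0 = iteratedFDeriv ℝ 2 F x ![e, e] := by
  have hline : ∀ t : ℝ, HasDerivAt (fun t : ℝ => x + t • e) e t := fun t => by
    simpa using ((hasDerivAt_id t).smul_const e).const_add x
  have hx : x + (0 : ℝ) • e = x := by simp
  have htend : Filter.Tendsto (fun t : ℝ => x + t • e) (𝓝 0) (𝓝 x) := by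
    simpa [hx] using (hline 0).continuousAt.tendsto
  have hev : (deriv fun t : ℝ => F (x + t • e)) =ᶠ[𝓝 0] fun t => fderiv ℝ F (x + t • e) e := by
    filter_upwards [htend.eventually (hF.eventually (by simp))] with t ht
    exact ((ht.differentiableAt (by simp)).hasFDerivAt.comp_hasDerivAt t (hline t)).deriv
  have h1 : HasFDerivAt (fderiv ℝ F) (fderiv ℝ (fderiv ℝ F) x) (x + (0 : ℝ) • e) := by
    rw [hx]
    have h : ContDiffAt ℝ 1 (fderiv ℝ F) x := hF.fderiv_right (by norm_num)
    exact (h.differentiableAt (by simp)).hasFDerivAt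
  have h2 : HasDerivAt (fun t : ℝ => fderiv ℝ F (x + t • e) e) (fderiv ℝ (fderiv ℝ F) x e e) 0 :=
    ((ContinuousLinearMap.apply ℝ ℝ e).hasFDerivAt.comp_hasDerivAt (0 : ℝ)
      (h1.comp_hasDerivAt (0 : ℝ) (hline 0)) :)
  rw [hev.deriv_eq, h2.deriv, iteratedFDeriv_two_apply]
  simp

variable [FiniteDimensional ℝ E]

lemma IsLocalMin.laplacian_nonneg {F : E → ℝ} {x : E} (hmin : IsLocalMin F x)
    (hF : ContDiffAt ℝ 2 F x) : 0 ≤ Laplacian.laplacian F x := by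
  rw [InnerProductSpace.laplacian_eq_iteratedFDeriv_stdOrthonormalBasis]
  refine Finset.sum_nonneg fun i _ => ?_
  set e := stdOrthonormalBasis ℝ E i
  rw [← hF.deriv_deriv_line e]
  have hx : x + (0 : ℝ) • e = x := by simp
  have hc : ContinuousAt (fun t : ℝ => x + t • e) 0 := by fun_prop
  refine IsLocalMin.deriv_deriv_nonneg ?_ ?_
  · have : Filter.Tendsto (fun t : ℝ => x + t • e) (𝓝 0) (𝓝 x) := by
      simpa [hx] using hc.tendsto
    have h := this.eventually hmin
    simpa [IsLocalMin, IsMinFilter, hx] using h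
  · exact ContinuousAt.comp (g := F) (by rw [hx]; exact hF.continuousAt) hc

/-- The Laplacian of a function `G (‖y - z‖ ^ 2)` of the squared distance to a point. -/
lemma laplacian_comp_norm_sub_sq {G G₁ : ℝ → ℝ} {G₂ : ℝ} {x z : E}
    (hG : ContDiffAt ℝ 2 G (‖x - z‖ ^ 2))
    (h₁ : ∀ᶠ q in 𝓝 (‖x - z‖ ^ 2), HasDerivAt G (G₁ q) q)
    (h₂ : HasDerivAt G₁ G₂ (‖x - z‖ ^ 2)) :
    Laplacian.laplacian (fun y => G (‖y - z‖ ^ 2)) x =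
      2 * Module.finrank ℝ E * G₁ (‖x - z‖ ^ 2) + 4 * ‖x - z‖ ^ 2 * G₂ := by
  have hF : ContDiffAt ℝ 2 (fun y => G (‖y - z‖ ^ 2)) x :=
    hG.comp x ((contDiffAt_id.sub contDiffAt_const).norm_sq ℝ)
  set b := stdOrthonormalBasis ℝ E
  have key : ∀ i, iteratedFDeriv ℝ 2 (fun y => G (‖y - z‖ ^ 2)) x ![b i, b i] =
      2 * G₁ (‖x - z‖ ^ 2) + 4 * (inner ℝ (b i) (x - z)) ^ 2 * G₂ := by
    intro i
    rw [← hF.deriv_deriv_line (b i)]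
    set c := inner ℝ (b i) (x - z) with hc
    have hq : ∀ t : ℝ, ‖x + t • b i - z‖ ^ 2 = ‖x - z‖ ^ 2 + 2 * c * t + t ^ 2 := by
      intro t
      rw [show x + t • b i - z = (x - z) + t • b i by abel, norm_add_sq_real, inner_smul_right,
        norm_smul, real_inner_comm, ← hc]
      simp [b.norm_eq_one]
      ring
    simp only [hq]
    have hp : ∀ t : ℝ, HasDerivAt (fun t : ℝ => ‖x - z‖ ^ 2 + 2 * c * t + t ^ 2)
        (2 * c + 2 * t) t := by
      intro t
      have h := (((hasDerivAt_id t).const_mul (2 * c)).const_add (‖x - z‖ ^ 2)).add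
        ((hasDerivAt_id t).pow 2)
      exact h.congr_deriv (by simp)
    have htend : Filter.Tendsto (fun t : ℝ => ‖x - z‖ ^ 2 + 2 * c * t + t ^ 2) (𝓝 0)
        (𝓝 (‖x - z‖ ^ 2)) := by
      simpa using (hp 0).continuousAt.tendsto
    have hev : (deriv fun t : ℝ => G (‖x - z‖ ^ 2 + 2 * c * t + t ^ 2)) =ᶠ[𝓝 0]
        fun t => G₁ (‖x - z‖ ^ 2 + 2 * c * t + t ^ 2) * (2 * c + 2 * t) := by
      filter_upwards [htend.eventually h₁] with t ht
      exact (ht.comp t (hp t)).deriv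
    have h₂' : HasDerivAt G₁ G₂ (‖x - z‖ ^ 2 + 2 * c * 0 + 0 ^ 2) := by simpa using h₂
    have hlin : HasDerivAt (fun t : ℝ => 2 * c + 2 * t) 2 0 := by
      simpa using ((hasDerivAt_id (0 : ℝ)).const_mul 2).const_add (2 * c)
    have h3 := (h₂'.comp 0 (hp 0)).mul hlin
    rw [hev.deriv_eq]
    refine h3.deriv.trans ?_
    simp only [Function.comp_apply]
    ring_nf
  rw [InnerProductSpace.laplacian_eq_iteratedFDeriv_stdOrthonormalBasis]
  simp only
  rw [Finset.sum_congr rfl fun i _ => key i, Finset.sum_add_distrib, Finset.sum_const,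
    ← Finset.sum_mul, ← Finset.mul_sum, b.sum_sq_inner_right]
  simp
  ring

end Laplacian

/-! ### The one-dimensional barrier -/

lemma contDiffOn_two_of_hasDerivAt {s : Set ℝ} (hs : IsOpen s) {W W₁ W₂ : ℝ → ℝ}
    (h₁ : ∀ r ∈ s, HasDerivAt W (W₁ r) r) (h₂ : ∀ r ∈ s, HasDerivAt W₁ (W₂ r) r)
    (hc : ContinuousOn W₂ s) : ContDiffOn ℝ 2 W s := by
  have hW₁ : ContDiffOn ℝ 1 W₁ s := by
    refine (contDiffOn_succ_iff_deriv_of_isOpen (n := 0) hs).2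
      ⟨fun r hr => (h₂ r hr).differentiableAt.differentiableWithinAt, by simp, ?_⟩
    exact contDiffOn_zero.2 (hc.congr fun r hr => (h₂ r hr).deriv)
  refine (contDiffOn_succ_iff_deriv_of_isOpen (n := 1) hs).2
    ⟨fun r hr => (h₁ r hr).differentiableAt.differentiableWithinAt, by simp, ?_⟩
  exact hW₁.congr fun r hr => (h₁ r hr).deriv

/-- The primitive of a function continuous on the positive half-line. -/
lemma ContinuousOn.hasDerivAt_integral_Ioi {φ : ℝ → ℝ} (hφ : ContinuousOn φ (Set.Ioi 0)) {a r : ℝ}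
    (ha : 0 < a) (hr : 0 < r) : HasDerivAt (fun x => ∫ s in a..x, φ s) (φ r) r := by
  have hsub : Set.uIcc a r ⊆ Set.Ioi 0 := fun s hs =>
    lt_of_lt_of_le (lt_min ha hr) hs.1
  exact intervalIntegral.integral_hasDerivAt_right (hφ.mono hsub).intervalIntegrable
    (hφ.stronglyMeasurableAtFilter isOpen_Ioi r hr) (hφ.continuousAt (Ioi_mem_nhds hr))

lemma ContinuousOn.integrableOn_mul_id_Icc {φ : ℝ → ℝ} (hφ : ContinuousOn φ (Set.Ioi 0)) {a : ℝ}
    (ha : 0 < a) (b : ℝ) : MeasureTheory.IntegrableOn (fun r => r * φ r) (Set.Icc a b) :=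
  ContinuousOn.integrableOn_Icc ((continuousOn_id.mul hφ).mono fun _ hs => ha.trans_le hs.1)

/-- Divergence of `∫ r φ(r) dr` at `0` means that its truncations are unbounded. -/
lemma exists_lt_integral_mul_id {φ : ℝ → ℝ} (hφ : ContinuousOn φ (Set.Ioi 0))
    (hφ_nonneg : ∀ r : ℝ, 0 < r → 0 ≤ φ r)
    (hφ_int : ∫⁻ r in Set.Ioc (0 : ℝ) 1, ENNReal.ofReal (r * φ r) = ⊤)
    {R ρ : ℝ} (hρ : 0 < ρ) (hρR : ρ ≤ R) (B : ℝ) :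
    ∃ ε, 0 < ε ∧ ε < ρ ∧ B < ∫ s in ε..R, s * φ s := by
  by_contra! hB
  have hR : 0 < R := hρ.trans_le hρR
  have h0 : Filter.Tendsto (fun n : ℕ => ρ / 2 * (1 / ((n : ℝ) + 1))) Filter.atTop (𝓝 0) := by
    simpa using tendsto_one_div_add_atTop_nhds_zero_nat.const_mul (ρ / 2)
  have hpos : ∀ n : ℕ, 0 < ρ / 2 * (1 / ((n : ℝ) + 1)) := fun n => by positivity
  have hlt : ∀ n : ℕ, ρ / 2 * (1 / ((n : ℝ) + 1)) < ρ := fun n => by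
    have h1 : 1 / ((n : ℝ) + 1) ≤ 1 := by
      rw [div_le_one (by positivity)]
      linarith [(Nat.cast_nonneg n : (0 : ℝ) ≤ n)]
    nlinarith
  have hI : MeasureTheory.IntegrableOn (fun r => r * φ r) (Set.Ioc 0 R) := by
    refine MeasureTheory.integrableOn_Ioc_of_intervalIntegral_norm_bounded_left (I := B)
      (fun n => (hφ.integrableOn_mul_id_Icc (hpos n) R).mono_set Set.Ioc_subset_Icc_self) h0
      (Filter.Eventually.of_forall fun n => ?_)
    refine le_trans (le_of_eq ?_) (hB _ (hpos n) (hlt n))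
    rw [intervalIntegral.integral_of_le ((hlt n).le.trans hρR)]
    refine MeasureTheory.setIntegral_congr_fun measurableSet_Ioc fun s hs => ?_
    have hs0 : 0 < s := (hpos n).trans hs.1
    exact Real.norm_of_nonneg (mul_nonneg hs0.le (hφ_nonneg s hs0))
  have hI1 : MeasureTheory.IntegrableOn (fun r => r * φ r) (Set.Ioc 0 1) :=
    (hI.union (hφ.integrableOn_mul_id_Icc hR 1)).mono_set fun s hs => by
      rcases le_total s R with h | h
      · exact Or.inl ⟨hs.1, h⟩
      · exact Or.inr ⟨h, hs.2⟩
  have hfin : ∫⁻ r in Set.Ioc (0 : ℝ) 1, ENNReal.ofReal (r * φ r) < ⊤ :=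
    MeasureTheory.Integrable.lintegral_lt_top hI1
  exact hfin.ne hφ_int

/-- The barrier `W = λ ∫_ε^r e^{K s} (∫_s^R φ) ds`, an increasing solution of
`-W'' + K W' = λ e^{K r} φ`. As `ε → 0` its value at `R` before normalization by `λ` tends to
infinity while `V R - V r` stays fixed; so, normalized by `W R = M`, it has a small `λ`, and its
value at any given point is close to `M`. -/
lemma exists_barrier {φ : ℝ → ℝ} (hφ : ContinuousOn φ (Set.Ioi 0))
    (hφ_nonneg : ∀ r : ℝ, 0 < r → 0 ≤ φ r)
    (hφ_int : ∫⁻ r in Set.Ioc (0 : ℝ) 1, ENNReal.ofReal (r * φ r) = ⊤)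
    {K R ρ c M : ℝ} (hK : 0 ≤ K) (hρ : 0 < ρ) (hρR : ρ ≤ R) (hc : 0 < c) (hM : 0 < M) :
    ∃ (ε : ℝ) (W W₁ W₂ : ℝ → ℝ), 0 < ε ∧ ε < ρ ∧ ContDiffOn ℝ 2 W (Set.Ioi 0) ∧
      (∀ r, 0 < r → HasDerivAt W (W₁ r) r) ∧ (∀ r, 0 < r → HasDerivAt W₁ (W₂ r) r) ∧
      W ε = 0 ∧ MonotoneOn W (Set.Ioc 0 R) ∧ W R = M ∧ 3 / 4 * M ≤ W ρ ∧
      (∀ r ∈ Set.Ioc 0 R, 0 ≤ W₁ r) ∧ ∀ r ∈ Set.Ioc 0 R, K * W₁ r - W₂ r ≤ c * φ r := by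
  have hR : 0 < R := hρ.trans_le hρR
  set P : ℝ → ℝ := fun r => -∫ s in R..r, φ s with hP
  have hPd : ∀ r, 0 < r → HasDerivAt P (-φ r) r := fun r hr =>
    (hφ.hasDerivAt_integral_Ioi hR hr).neg
  have hPc : ContinuousOn P (Set.Ioi 0) := fun r hr =>
    (hPd r hr).continuousAt.continuousWithinAt
  have hPR : P R = 0 := by simp [hP]
  have hPanti : AntitoneOn P (Set.Ioi 0) := by
    refine antitoneOn_of_deriv_nonpos (convex_Ioi 0) hPc
      (fun r hr => (hPd r (interior_subset hr)).differentiableAt.differentiableWithinAt)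
      fun r hr => ?_
    have hr0 : 0 < r := interior_subset hr
    rw [(hPd r hr0).deriv]
    linarith [hφ_nonneg r hr0]
  have hPnn : ∀ r ∈ Set.Ioc 0 R, 0 ≤ P r := fun r hr => hPR ▸ hPanti hr.1 hR hr.2
  set V₁ : ℝ → ℝ := fun r => Real.exp (K * r) * P r with hV₁
  set V₂ : ℝ → ℝ := fun r => K * V₁ r - Real.exp (K * r) * φ r with hV₂
  have hed : ∀ r : ℝ, HasDerivAt (fun r => Real.exp (K * r)) (Real.exp (K * r) * K) r := fun r => by
    simpa using ((hasDerivAt_id r).const_mul K).exp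
  have hV₁d : ∀ r, 0 < r → HasDerivAt V₁ (V₂ r) r := fun r hr =>
    ((hed r).mul (hPd r hr)).congr_deriv (by simp only [hV₂, hV₁]; ring)
  have hV₁c : ContinuousOn V₁ (Set.Ioi 0) := fun r hr =>
    (hV₁d r hr).continuousAt.continuousWithinAt
  have hV₂c : ContinuousOn V₂ (Set.Ioi 0) :=
    (hV₁c.const_mul K).sub (ContinuousOn.mul (by fun_prop) hφ)
  have hV₁nn : ∀ r ∈ Set.Ioc 0 R, 0 ≤ V₁ r := fun r hr =>
    mul_nonneg (Real.exp_pos _).le (hPnn r hr)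
  have hV₁P : ∀ r ∈ Set.Ioc 0 R, P r ≤ V₁ r := fun r hr =>
    le_mul_of_one_le_left (hPnn r hr) (Real.one_le_exp (mul_nonneg hK hr.1.le))
  set V : ℝ → ℝ := fun r => ∫ s in R..r, V₁ s with hV
  have hVd : ∀ r, 0 < r → HasDerivAt V (V₁ r) r := fun r hr =>
    hV₁c.hasDerivAt_integral_Ioi hR hr
  have hVR : V R = 0 := by simp [hV]
  have hmono : ∀ (g g' : ℝ → ℝ) (b : ℝ), (∀ r ∈ Set.Ioc 0 b, HasDerivAt g (g' r) r) →
      (∀ r ∈ Set.Ioc 0 b, 0 ≤ g' r) → MonotoneOn g (Set.Ioc 0 b) := by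
    intro g g' b hg hg'
    refine monotoneOn_of_deriv_nonneg (convex_Ioc 0 b)
      (fun r hr => (hg r hr).continuousAt.continuousWithinAt)
      (fun r hr => (hg r (interior_subset hr)).differentiableAt.differentiableWithinAt)
      fun r hr => ?_
    rw [(hg r (interior_subset hr)).deriv]
    exact hg' r (interior_subset hr)
  have hVmono : MonotoneOn V (Set.Ioc 0 R) := hmono V V₁ R (fun r hr => hVd r hr.1) hV₁nn
  have hVnp : ∀ r ∈ Set.Ioc 0 R, V r ≤ 0 := fun r hr => hVR ▸ hVmono hr ⟨hR, le_rfl⟩ hr.2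
  -- Integration by parts, as the monotonicity of `∫_r^R s φ - r P r + V r`.
  have hparts : ∀ r ∈ Set.Ioc 0 R, ∫ s in r..R, s * φ s ≤ r * P r - V r := by
    intro r hr
    have hI : ∀ r, 0 < r → HasDerivAt (fun x => ∫ s in R..x, s * φ s) (r * φ r) r := fun r hr =>
      ContinuousOn.hasDerivAt_integral_Ioi (continuousOn_id.mul hφ) hR hr
    have hm := hmono (fun r => -(∫ s in R..r, s * φ s) - r * P r + V r)
      (fun r => V₁ r - P r) R
      (fun r hr => ((((hI r hr.1).neg.sub ((hasDerivAt_id r).mul (hPd r hr.1))).add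
        (hVd r hr.1)).congr_deriv (by simp; ring)))
      (fun r hr => sub_nonneg.2 (hV₁P r hr)) hr ⟨hR, le_rfl⟩ hr.2
    simp only [hVR, hPR, intervalIntegral.integral_same] at hm
    rw [intervalIntegral.integral_symm]
    linarith
  -- Since `P` is decreasing, `(r / 2) P r ≤ ∫_{r/2}^r P ≤ -V (r / 2)`.
  have hrP : ∀ r ∈ Set.Ioc 0 R, r / 2 * P r ≤ -V (r / 2) := by
    intro r hr
    have hm := hmono (fun x => V x - x * P r) (fun x => V₁ x - P r) r
      (fun x hx => ((hVd x hx.1).sub ((hasDerivAt_id x).mul_const (P r))).congr_deriv (by simp))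
      (fun x hx => by
        have h1 := hPanti (show x ∈ Set.Ioi 0 from hx.1) (show r ∈ Set.Ioi 0 from hr.1) hx.2
        have h2 := hV₁P x ⟨hx.1, hx.2.trans hr.2⟩
        linarith)
      (show r / 2 ∈ Set.Ioc 0 r from ⟨by linarith [hr.1], by linarith [hr.1]⟩)
      (show r ∈ Set.Ioc 0 r from ⟨hr.1, le_rfl⟩)
      (by linarith [hr.1])
    simp only at hm
    linarith [hVnp r hr]
  have hdiv : ∀ B : ℝ, ∃ ε, 0 < ε ∧ ε < ρ ∧ V ε < -B := by
    intro B
    obtain ⟨ε, hε, hερ, hlt⟩ := exists_lt_integral_mul_id hφ hφ_nonneg hφ_int hρ hρR (3 * B)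
    have hεR : ε ∈ Set.Ioc 0 R := ⟨hε, hερ.le.trans hρR⟩
    refine ⟨ε / 2, by linarith, by linarith, ?_⟩
    have h1 := hparts ε hεR
    have h2 := hrP ε hεR
    have h3 : V (ε / 2) ≤ V ε := hVmono ⟨by linarith, by linarith [hεR.2]⟩ hεR (by linarith)
    linarith
  obtain ⟨ε, hε, hερ, hVε⟩ := hdiv (max (M * Real.exp (K * R) / c) (-(4 * V ρ)))
  have hVε1 : M * Real.exp (K * R) / c < -V ε := by
    linarith [le_max_left (M * Real.exp (K * R) / c) (-(4 * V ρ))]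
  have hVε2 : -(4 * V ρ) < -V ε := by
    linarith [le_max_right (M * Real.exp (K * R) / c) (-(4 * V ρ))]
  have hVneg : 0 < -V ε := lt_of_le_of_lt (by positivity) hVε1
  set l : ℝ := M / (-V ε) with hl
  have hl0 : 0 < l := div_pos hM hVneg
  have hlV : l * (-V ε) = M := div_mul_cancel₀ M hVneg.ne'
  have hlc : l * Real.exp (K * R) ≤ c := by
    rw [hl, div_mul_eq_mul_div, div_le_iff₀ hVneg]
    rw [div_lt_iff₀ hc] at hVε1
    linarith
  refine ⟨ε, fun r => l * (V r - V ε), fun r => l * V₁ r, fun r => l * V₂ r, hε, hερ, ?_,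
    fun r hr => ((hVd r hr).sub_const _).const_mul l, fun r hr => (hV₁d r hr).const_mul l,
    by simp, fun x hx y hy hxy => ?_, ?_, ?_, fun r hr => mul_nonneg hl0.le (hV₁nn r hr),
    fun r hr => ?_⟩
  · exact contDiffOn_two_of_hasDerivAt isOpen_Ioi
      (fun r hr => ((hVd r hr).sub_const _).const_mul l) (fun r hr => (hV₁d r hr).const_mul l)
      (hV₂c.const_mul l)
  · exact mul_le_mul_of_nonneg_left (sub_le_sub_right (hVmono hx hy hxy) _) hl0.le
  · simp only [hVR]
    linarith
  · nlinarith
  · have h1 : Real.exp (K * r) ≤ Real.exp (K * R) :=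
      Real.exp_le_exp.2 (mul_le_mul_of_nonneg_left hr.2 hK)
    have h2 : l * Real.exp (K * r) ≤ c := (mul_le_mul_of_nonneg_left h1 hl0.le).trans hlc
    calc K * (l * V₁ r) - l * V₂ r = l * Real.exp (K * r) * φ r := by simp only [hV₂]; ring
      _ ≤ c * φ r := mul_le_mul_of_nonneg_right h2 (hφ_nonneg r hr.1)

/-! ### Exterior balls and the boundary distance -/

lemma HasDerivAt.eventually_lt_nhdsGT {f : ℝ → ℝ} {d a : ℝ} (hf : HasDerivAt f d a) (hd : d < 0) :
    ∀ᶠ t in 𝓝[>] a, f t < f a := by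
  have h := (hasDerivAt_iff_tendsto_slope.1 hf).eventually_lt_const hd
  have h' := h.filter_mono (nhdsWithin_mono a fun t (ht : t ∈ Set.Ioi a) => (ne_of_gt ht : t ≠ a))
  filter_upwards [h', self_mem_nhdsWithin] with t ht hta
  rw [slope_def_field, div_neg_iff] at ht
  have : 0 < t - a := sub_pos.2 hta
  rcases ht with ht | ht <;> linarith [ht.1, ht.2]

section ExteriorBall

variable {E : Type*} [NormedAddCommGroup E] [InnerProductSpace ℝ E]

/-- If `g` is nonnegative on a ball touching `{g = 0}` at `y`, then the centre of the ball lies on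
the ray from `y` in the direction of the gradient `a • n` of `g` at `y`. -/
lemma eq_add_dist_smul_of_ball_subset_nonneg {g : E → ℝ} {x y n : E} {a : ℝ} {D : E →L[ℝ] ℝ}
    (hD : HasFDerivAt g D y) (ha : 0 < a) (hn : ‖n‖ = 1) (hDn : ∀ w, D w = a * inner ℝ n w)
    (hgy : g y = 0) (hxy : x ≠ y) (hg : ∀ᶠ p in 𝓝 y, p ∈ Metric.ball x (dist x y) → 0 ≤ g p) :
    x = y + dist x y • n := by
  set r := dist x y with hr
  have hr0 : 0 < r := dist_pos.2 hxy
  have hrn : ‖x - y‖ = r := by rw [hr, dist_eq_norm]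
  set e := r⁻¹ • (x - y) with he
  have hxe : x - y = r • e := by rw [he, smul_inv_smul₀ hr0.ne']
  have hen : ‖e‖ = 1 := by
    rw [he, norm_smul, hrn, norm_inv, Real.norm_of_nonneg hr0.le, inv_mul_cancel₀ hr0.ne']
  suffices h : e = n by rw [← h, ← hxe]; abel
  by_contra hne
  have hlt : inner ℝ n e < 1 := by
    have h := (inner_lt_one_iff_real_of_norm_eq_one hn hen).2 (Ne.symm hne)
    exact h
  -- The direction `e - n` points into the ball, and `g` decreases along it.
  have hline : HasDerivAt (fun t : ℝ => y + t • (e - n)) (e - n) 0 := by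
    simpa using ((hasDerivAt_id (0 : ℝ)).smul_const (e - n)).const_add y
  have h1 : HasDerivAt (fun t : ℝ => g (y + t • (e - n))) (D (e - n)) 0 :=
    HasFDerivAt.comp_hasDerivAt (l := g) (0 : ℝ) (by simpa using hD) hline
  have hd1 : D (e - n) < 0 := by
    rw [hDn, inner_sub_right, real_inner_self_eq_norm_sq, hn]
    nlinarith
  have h2 : HasDerivAt (fun t : ℝ => ‖(y + t • (e - n)) - x‖ ^ 2)
      (2 * inner ℝ (y + (0 : ℝ) • (e - n) - x) (e - n)) 0 := (hline.sub_const x).norm_sq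
  have hd2 : 2 * inner ℝ (y + (0 : ℝ) • (e - n) - x) (e - n) < 0 := by
    rw [zero_smul, add_zero, ← neg_sub x y, hxe, inner_neg_left, inner_smul_left, inner_sub_right,
      real_inner_self_eq_norm_sq, hen, real_inner_comm]
    simp only [conj_trivial]
    nlinarith
  have htend : Filter.Tendsto (fun t : ℝ => y + t • (e - n)) (𝓝[>] 0) (𝓝 y) := by
    have := hline.continuousAt.tendsto
    simp only [zero_smul, add_zero] at this
    exact this.mono_left nhdsWithin_le_nhds
  obtain ⟨t, ht1, ht2, ht3⟩ :=
    ((h1.eventually_lt_nhdsGT hd1).and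
      ((h2.eventually_lt_nhdsGT hd2).and (htend.eventually hg))).exists
  simp only [zero_smul, add_zero, hgy] at ht1 ht2
  have hb : y + t • (e - n) ∈ Metric.ball x r := by
    rw [Metric.mem_ball, dist_eq_norm]
    rw [norm_sub_rev y x, hrn] at ht2
    exact lt_of_pow_lt_pow_left₀ 2 hr0.le ht2
  linarith [ht3 hb]

/-- A `C²` boundary has, near each of its points, exterior balls of a uniform radius, centred on
the normals along which the boundary distance is realized. -/
lemma exists_uniform_exterior_ball [CompleteSpace E] {Ω : Set E} (hΩ : IsOpen Ω) {g : E → ℝ} {p : E}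
    (hg : ContDiffAt ℝ 2 g p) (hgp : fderiv ℝ g p ≠ 0) (hloc : ∀ᶠ y in 𝓝 p, (y ∈ Ω ↔ g y < 0)) :
    ∃ ρ > 0, ∃ η > 0, ∀ y ∈ frontier Ω, dist y p < η → ∃ n : E, ‖n‖ = 1 ∧
      Metric.ball (y + ρ • n) ρ ⊆ Ωᶜ ∧
      ∀ x, x ≠ y → Metric.ball x (dist x y) ⊆ Ωᶜ → x = y + dist x y • n := by
  have hg1 : ContDiffAt ℝ 1 (fderiv ℝ g) p := hg.fderiv_right (by norm_num)
  obtain ⟨L, t, ht, hL⟩ := hg1.exists_lipschitzOnWith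
  set m := ‖fderiv ℝ g p‖ / 2 with hm
  have hm0 : 0 < m := half_pos (norm_pos_iff.2 hgp)
  have hmev : ∀ᶠ y in 𝓝 p, m < ‖fderiv ℝ g y‖ :=
    hg1.continuousAt.norm.eventually_const_lt (by linarith : m < ‖fderiv ℝ g p‖)
  obtain ⟨σ, hσ, hball⟩ := Metric.eventually_nhds_iff_ball.1
    ((hg.eventually (by simp)).and (hloc.and (hmev.and ht)))
  refine ⟨min (σ / 4) (m / (2 * (L + 1))), by positivity, σ / 2, by positivity, fun y hy hyp => ?_⟩
  set ρ := min (σ / 4) (m / (2 * (L + 1))) with hρ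
  have hρ0 : 0 < ρ := by positivity
  have hρσ : ρ ≤ σ / 4 := min_le_left _ _
  have hρm : 2 * (L + 1) * ρ ≤ m := by
    have : ρ ≤ m / (2 * (L + 1)) := min_le_right _ _
    rw [le_div_iff₀ (by positivity)] at this
    linarith
  have hyb : y ∈ Metric.ball p σ := by
    rw [Metric.mem_ball]
    linarith
  obtain ⟨hgC, hyΩ, hmy, hyt⟩ := hball y hyb
  have hgd : HasFDerivAt g (fderiv ℝ g y) y := (hgC.differentiableAt (by simp)).hasFDerivAt
  have hbn : Metric.ball p σ ∈ 𝓝 y := Metric.isOpen_ball.mem_nhds hyb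
  have hgy : g y = 0 := by
    rw [hΩ.frontier_eq] at hy
    refine le_antisymm ?_ (not_lt.1 fun h => hy.2 (hyΩ.2 h))
    by_contra! hpos
    have hev := hgd.continuousAt.eventually_const_lt hpos
    obtain ⟨q, hq, hq1, hq2⟩ :=
      ((mem_closure_iff_frequently.1 hy.1).and_eventually (hev.and hbn)).exists
    exact lt_asymm hq1 ((hball q hq2).2.1.1 hq)
  set a := ‖fderiv ℝ g y‖ with ha
  have ha0 : 0 < a := hm0.trans hmy
  set n := a⁻¹ • (InnerProductSpace.toDual ℝ E).symm (fderiv ℝ g y) with hn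
  have hnn : ‖n‖ = 1 := by
    rw [hn, norm_smul, LinearIsometryEquiv.norm_map, norm_inv, Real.norm_of_nonneg ha0.le, ← ha,
      inv_mul_cancel₀ ha0.ne']
  have hDn : ∀ w, fderiv ℝ g y w = a * inner ℝ n w := by
    intro w
    rw [hn, inner_smul_left, InnerProductSpace.toDual_symm_apply]
    simp only [conj_trivial]
    rw [mul_inv_cancel_left₀ ha0.ne']
  refine ⟨n, hnn, fun x hx hxΩ => ?_, fun x hxy hx => ?_⟩
  · have hsq : ‖x - y‖ ^ 2 < 2 * ρ * inner ℝ n (x - y) := by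
      rw [Metric.mem_ball, dist_eq_norm] at hx
      have h1 : ‖x - (y + ρ • n)‖ ^ 2 < ρ ^ 2 := pow_lt_pow_left₀ hx (norm_nonneg _) two_ne_zero
      rw [← sub_sub, norm_sub_sq_real, norm_smul, hnn, inner_smul_right, real_inner_comm,
        Real.norm_of_nonneg hρ0.le] at h1
      linarith
    have hxy : ‖x - y‖ < 2 * ρ := by
      have h1 : inner ℝ n (x - y) ≤ ‖x - y‖ := by
        simpa [hnn] using real_inner_le_norm n (x - y)
      by_contra! h
      nlinarith
    have hsub : Metric.closedBall y ‖x - y‖ ⊆ Metric.ball p σ := fun q hq => by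
      rw [Metric.mem_closedBall] at hq
      rw [Metric.mem_ball]
      linarith [dist_triangle q y p]
    have hxm : x ∈ Metric.closedBall y ‖x - y‖ := by
      rw [Metric.mem_closedBall, dist_eq_norm]
    have hmv := (convex_closedBall y ‖x - y‖).norm_image_sub_le_of_norm_fderiv_le' (𝕜 := ℝ)
      (f := g) (φ := fderiv ℝ g y) (C := L * ‖x - y‖)
      (fun q hq => (hball q (hsub hq)).1.differentiableAt (by simp))
      (fun q hq => by
        refine (hL.norm_sub_le (hball q (hsub hq)).2.2.2 hyt).trans ?_
        rw [Metric.mem_closedBall, dist_eq_norm] at hq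
        exact mul_le_mul_of_nonneg_left hq L.2)
      (Metric.mem_closedBall_self (norm_nonneg _)) hxm
    have hgx : g x < 0 := (hball x (hsub hxm)).2.1.1 hxΩ
    rw [hgy, hDn, Real.norm_eq_abs] at hmv
    have h1 := (abs_le.1 hmv).1
    set s := inner ℝ n (x - y)
    have hs : 0 < s := by
      by_contra! h
      nlinarith [sq_nonneg ‖x - y‖]
    have h2 : L * ‖x - y‖ ^ 2 ≤ L * (2 * ρ * s) := mul_le_mul_of_nonneg_left hsq.le L.2
    have h3 : (2 * (L + 1) * ρ) * s ≤ a * s :=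
      mul_le_mul_of_nonneg_right (hρm.trans hmy.le) hs.le
    nlinarith [mul_pos hρ0 hs]
  · refine eq_add_dist_smul_of_ball_subset_nonneg hgd ha0 hnn hDn hgy hxy ?_
    filter_upwards [hbn] with q hq hqx
    exact not_lt.1 fun h => hx hqx ((hball q hq).2.1.2 h)

end ExteriorBall

section BoundaryDist

variable {N : ℕ} {Ω : Set (EuclideanSpace ℝ (Fin N))}

lemma continuous_boundaryDist : Continuous (boundaryDist Ω) :=
  Metric.continuous_infDist_pt _

lemma boundaryDist_le_dist {x y : EuclideanSpace ℝ (Fin N)} (hy : y ∈ frontier Ω) :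
    boundaryDist Ω x ≤ dist x y :=
  Metric.infDist_le_dist_of_mem hy

/-- Outside `Ω`, the boundary distance is realized, as the distance to `Ω`. -/
lemma exists_boundaryDist_eq_dist (hne : Ω.Nonempty) {x : EuclideanSpace ℝ (Fin N)} (hx : x ∉ Ω) :
    ∃ y ∈ frontier Ω, boundaryDist Ω x = dist x y ∧ Metric.ball x (dist x y) ⊆ Ωᶜ := by
  have hne' : Ωᶜ ≠ Set.univ := by simpa [Set.compl_univ_iff] using hne.ne_empty
  obtain ⟨y, hy, hd⟩ := exists_mem_frontier_infDist_compl_eq_dist (s := Ωᶜ) hx hne'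
  rw [frontier_compl] at hy
  rw [compl_compl] at hd
  refine ⟨y, hy, le_antisymm (boundaryDist_le_dist hy) ?_, ?_⟩
  · rw [← hd, ← Metric.infDist_closure]
    exact Metric.infDist_le_infDist_of_subset frontier_subset_closure ⟨y, hy⟩
  · rw [← hd]
    exact Metric.ball_infDist_subset_compl

/-- Inside an exterior ball, the distance to the sphere bounds the boundary distance below. -/
lemma sub_dist_le_boundaryDist (hfr : (frontier Ω).Nonempty) {x z : EuclideanSpace ℝ (Fin N)}
    {ρ : ℝ} (hz : Metric.ball z ρ ⊆ Ωᶜ) : ρ - dist x z ≤ boundaryDist Ω x := by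
  refine (Metric.le_infDist hfr).2 fun y hy => ?_
  have hy' : y ∉ Metric.ball z ρ := fun h => by
    obtain ⟨q, hq1, hq2⟩ := mem_closure_iff.1 hy.1 _ Metric.isOpen_ball h
    exact hz hq1 hq2
  rw [Metric.mem_ball, not_lt] at hy'
  linarith [dist_triangle_left y z x]

end BoundaryDist

/-! ### The auxiliary functions of the comparison argument -/

section Radial

variable {E : Type*} [NormedAddCommGroup E] [InnerProductSpace ℝ E]

lemma contDiffAt_comp_sub_norm {W : ℝ → ℝ} {x z : E} {ρ : ℝ} (hxz : x ≠ z)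
    (hW : ContDiffAt ℝ 2 W (ρ - ‖x - z‖)) : ContDiffAt ℝ 2 (fun y => W (ρ - ‖y - z‖)) x :=
  ContDiffAt.comp x hW
    (contDiffAt_const.sub ((contDiffAt_id.sub contDiffAt_const).norm ℝ (sub_ne_zero.2 hxz)))

lemma contDiff_exp_neg_mul_norm_sub_sq (α : ℝ) (z : E) :
    ContDiff ℝ 2 (fun y => Real.exp (-α * ‖y - z‖ ^ 2)) :=
  (contDiff_const.mul ((contDiff_id.sub contDiff_const).norm_sq ℝ)).exp

variable [FiniteDimensional ℝ E]

/-- The Laplacian of a function of the distance to a sphere. -/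
lemma laplacian_comp_sub_norm {W W₁ W₂ : ℝ → ℝ} {x z : E} {ρ : ℝ} (hxz : x ≠ z)
    (hW : ContDiffAt ℝ 2 W (ρ - ‖x - z‖))
    (h₁ : ∀ᶠ r in 𝓝 (ρ - ‖x - z‖), HasDerivAt W (W₁ r) r)
    (h₂ : HasDerivAt W₁ (W₂ (ρ - ‖x - z‖)) (ρ - ‖x - z‖)) :
    Laplacian.laplacian (fun y => W (ρ - ‖y - z‖)) x =
      W₂ (ρ - ‖x - z‖) - (Module.finrank ℝ E - 1) / ‖x - z‖ * W₁ (ρ - ‖x - z‖) := by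
  set s := ‖x - z‖ with hs
  have hs0 : 0 < s := norm_pos_iff.2 (sub_ne_zero.2 hxz)
  have hs2 : s ^ 2 ≠ 0 := by positivity
  have hsq : √(s ^ 2) = s := Real.sqrt_sq hs0.le
  have hd : ∀ q : ℝ, 0 < q → HasDerivAt (fun q => ρ - √q) (-(1 / (2 * √q))) q := fun q hq =>
    (Real.hasDerivAt_sqrt hq.ne').const_sub ρ
  have hcont : Filter.Tendsto (fun q => ρ - √q) (𝓝 (s ^ 2)) (𝓝 (ρ - s)) := by
    have := (hd (s ^ 2) (by positivity)).continuousAt.tendsto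
    rwa [hsq] at this
  have hinv : HasDerivAt (fun q : ℝ => -(1 / (2 * √q))) (1 / (4 * s ^ 3)) (s ^ 2) := by
    have h : HasDerivAt (fun q : ℝ => (2 * √q)⁻¹) (-(2 * (1 / (2 * √(s ^ 2)))) /
        (2 * √(s ^ 2)) ^ 2) (s ^ 2) :=
      ((Real.hasDerivAt_sqrt hs2).const_mul 2).inv (by rw [hsq]; positivity)
    simp only [one_div] at h ⊢
    refine h.neg.congr_deriv ?_
    rw [hsq]
    field_simp
    norm_num
  have hL := laplacian_comp_norm_sub_sq (x := x) (z := z) (G := fun q => W (ρ - √q))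
    (G₁ := fun q => W₁ (ρ - √q) * -(1 / (2 * √q)))
    (G₂ := W₂ (ρ - s) * -(1 / (2 * s)) * -(1 / (2 * s)) + W₁ (ρ - s) * (1 / (4 * s ^ 3)))
    (by
      have hsub : ContDiffAt ℝ 2 (fun q => ρ - √q) (s ^ 2) :=
        contDiffAt_const.sub (Real.contDiffAt_sqrt hs2)
      exact ContDiffAt.comp (s ^ 2) (by rw [hsq]; exact hW) hsub)
    (by
      filter_upwards [hcont.eventually h₁, eventually_gt_nhds (show 0 < s ^ 2 by positivity)]
        with q hq hq0
      exact hq.comp q (hd q hq0))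
    (by
      have h := HasDerivAt.comp (s ^ 2) (h₂ := W₁) (h := fun q => ρ - √q)
        (by rw [hsq]; exact h₂) (hd (s ^ 2) (by positivity))
      refine (h.mul hinv).congr_deriv ?_
      simp only [Function.comp_apply, hsq])
  simp only [Real.sqrt_sq (norm_nonneg _)] at hL
  rw [hL, ← hs]
  field_simp
  ring

/-- A Gaussian is strictly subharmonic away from its centre. -/
lemma laplacian_exp_neg_mul_norm_sub_sq_pos {α : ℝ} {x z : E} (hα : 0 < α)
    (h : Module.finrank ℝ E < 2 * α * ‖x - z‖ ^ 2) :
    0 < Laplacian.laplacian (fun y => Real.exp (-α * ‖y - z‖ ^ 2)) x := by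
  have hd : ∀ q : ℝ, HasDerivAt (fun q => Real.exp (-α * q)) (Real.exp (-α * q) * -α) q :=
    fun q => by simpa using ((hasDerivAt_id q).const_mul (-α)).exp
  have hL := laplacian_comp_norm_sub_sq (x := x) (z := z) (G := fun q => Real.exp (-α * q))
    (G₁ := fun q => Real.exp (-α * q) * -α)
    (contDiff_const.mul contDiff_id).exp.contDiffAt (Filter.Eventually.of_forall hd)
    ((hd _).mul_const (-α))
  rw [hL]
  have he := Real.exp_pos (-α * ‖x - z‖ ^ 2)
  have : 0 < Real.exp (-α * ‖x - z‖ ^ 2) * α *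
      (2 * (2 * α * ‖x - z‖ ^ 2 - Module.finrank ℝ E)) := by
    have : 0 < 2 * α * ‖x - z‖ ^ 2 - Module.finrank ℝ E := sub_pos.2 h
    positivity
  linarith

/-- At a boundary point nearest to an interior point there is an interior ball; halving its radius
makes it touch the complement at that point only, quantitatively. -/
lemma exists_frontier_strict_interior_ball {Ω : Set E} (hΩ : IsOpen Ω) (hne : Ω.Nonempty)
    (hne' : Ω ≠ Set.univ) : ∃ p ∈ frontier Ω, ∃ z : E, ∃ a : ℝ, 0 < a ∧ ‖p - z‖ ^ 2 = a ∧
      ∀ x ∉ Ω, a + ‖x - p‖ ^ 2 / 2 ≤ ‖x - z‖ ^ 2 := by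
  obtain ⟨w, hw⟩ := hne
  obtain ⟨p, hp, hd⟩ := exists_mem_frontier_infDist_compl_eq_dist hw hne'
  have hpw : p ≠ w := fun h => by
    rw [hΩ.frontier_eq] at hp
    exact hp.2 (h ▸ hw)
  have hhalf : ∀ x : E, ‖x - (1 / 2 : ℝ) • (w + p)‖ ^ 2 =
      ‖x - w‖ ^ 2 / 2 + ‖x - p‖ ^ 2 / 2 - ‖p - w‖ ^ 2 / 4 := by
    intro x
    have h1 : x - (1 / 2 : ℝ) • (w + p) = (1 / 2 : ℝ) • ((x - w) + (x - p)) := by module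
    have h2 : p - w = (x - w) - (x - p) := by abel
    have h3 := norm_add_sq_real (x - w) (x - p)
    have h4 := norm_sub_sq_real (x - w) (x - p)
    rw [← h2] at h4
    rw [h1, norm_smul, mul_pow, Real.norm_of_nonneg (by norm_num)]
    linarith
  have hpos : 0 < ‖p - w‖ := norm_pos_iff.2 (sub_ne_zero.2 hpw)
  refine ⟨p, hp, (1 / 2 : ℝ) • (w + p), ‖p - w‖ ^ 2 / 4, by positivity, ?_, fun x hx => ?_⟩
  · rw [hhalf, sub_self, norm_zero]
    ring
  · have h1 : x ∉ Metric.ball w (dist w p) := fun h =>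
      hx (Metric.ball_infDist_compl_subset (hd ▸ h))
    rw [Metric.mem_ball, not_lt, dist_comm w p, dist_eq_norm, dist_eq_norm] at h1
    rw [hhalf]
    nlinarith [norm_nonneg (p - w)]

/-- A superharmonic barrier at some boundary point `p`: nonnegative outside `Ω`, vanishing at `p`
only, and strictly superharmonic. It is the difference of a constant and a Gaussian centred at the
centre of an interior ball touching `∂Ω` at `p`. -/
lemma exists_superharmonic_barrier {Ω : Set E} (hΩ : IsOpen Ω) (hne : Ω.Nonempty)
    (hne' : Ω ≠ Set.univ) (hE : 0 < Module.finrank ℝ E) :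
    ∃ p ∈ frontier Ω, ∃ H : E → ℝ, ContDiff ℝ 2 H ∧ H p = 0 ∧
      (∀ x ∉ Ω, 0 ≤ H x ∧ Laplacian.laplacian H x < 0) ∧
      ∀ R > 0, ∃ m > 0, ∀ x ∉ Ω, dist x p = R → m ≤ H x := by
  obtain ⟨p, hp, z, a, ha, hpz, hza⟩ := exists_frontier_strict_interior_ball hΩ hne hne'
  have hE' : (0 : ℝ) < Module.finrank ℝ E := by exact_mod_cast hE
  -- The Gaussian is strictly subharmonic where `‖x - z‖ ^ 2 > finrank / (2 α)`, hence where
  -- `‖x - z‖ ^ 2 ≥ a`.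
  set α : ℝ := Module.finrank ℝ E / a
  have hα0 : 0 < α := by positivity
  have hαa : α * a = Module.finrank ℝ E := div_mul_cancel₀ _ ha.ne'
  have hge : ∀ b x, b ≤ ‖x - z‖ ^ 2 → Real.exp (-α * a) - Real.exp (-α * b) ≤
      Real.exp (-α * a) - Real.exp (-α * ‖x - z‖ ^ 2) := fun b x hb =>
    sub_le_sub_left (Real.exp_le_exp.2 (by nlinarith)) _
  have hxa : ∀ x ∉ Ω, a ≤ ‖x - z‖ ^ 2 := fun x hx => by
    nlinarith [hza x hx, sq_nonneg ‖x - p‖]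
  refine ⟨p, hp, fun x => Real.exp (-α * a) - Real.exp (-α * ‖x - z‖ ^ 2),
    contDiff_const.sub (contDiff_exp_neg_mul_norm_sub_sq α z), by simp [hpz],
    fun x hx => ⟨by simpa using hge a x (hxa x hx), ?_⟩, fun R hR =>
    ⟨Real.exp (-α * a) - Real.exp (-α * (a + R ^ 2 / 2)), ?_, fun x hx hxR => hge _ x ?_⟩⟩
  · have h1 := laplacian_exp_neg_mul_norm_sub_sq_pos (x := x) (z := z) hα0
      (by nlinarith [mul_le_mul_of_nonneg_left (hxa x hx) hα0.le])
    have h2 := (contDiffAt_const (c := Real.exp (-α * a))).laplacian_sub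
      ((contDiff_exp_neg_mul_norm_sub_sq α z).contDiffAt (x := x))
    rw [InnerProductSpace.laplacian_const, Pi.zero_apply, zero_sub] at h2
    exact h2.trans_lt (neg_lt_zero.2 h1)
  · exact sub_pos.2 (Real.exp_lt_exp.2 (by nlinarith [mul_pos hα0 (pow_pos hR 2)]))
  · rw [← hxR, dist_eq_norm]
    exact hza x hx

end Radial

/-- A positive continuous function with positive lower limit at `0` is bounded below by a positive
constant on every `(0, M]`. -/
lemma exists_pos_le_of_liminf_pos {f : ℝ → ℝ} (hf_cont : ContinuousOn f (Set.Ioi 0))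
    (hf_pos : ∀ t : ℝ, 0 < t → 0 < f t)
    (hf_liminf : 0 < Filter.liminf (fun t : ℝ => (f t : EReal)) (𝓝[>] (0 : ℝ))) (M : ℝ) :
    ∃ c > 0, ∀ t ∈ Set.Ioc 0 M, c ≤ f t := by
  obtain ⟨b, hb0, hb⟩ := EReal.lt_iff_exists_real_btwn.1 hf_liminf
  have hev := Filter.eventually_lt_of_lt_liminf hb
  obtain ⟨τ, hτ, hτb⟩ := mem_nhdsGT_iff_exists_Ioo_subset.1 hev
  have hτ0 : (0 : ℝ) < τ := hτ
  have hb0' : 0 < b := EReal.coe_pos.1 hb0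
  rcases le_or_gt τ M with hM | hM
  · obtain ⟨s, hs, hmin⟩ := isCompact_Icc.exists_isMinOn (Set.nonempty_Icc.2 hM)
      (hf_cont.mono fun t ht => hτ0.trans_le ht.1)
    refine ⟨min b (f s), lt_min hb0' (hf_pos s (hτ0.trans_le hs.1)), fun t ht => ?_⟩
    rcases lt_or_ge t τ with h | h
    · exact (min_le_left _ _).trans (EReal.coe_lt_coe_iff.1 (hτb ⟨ht.1, h⟩)).le
    · exact (min_le_right _ _).trans (hmin ⟨h, ht.2⟩)
  · exact ⟨b, hb0', fun t ht =>
      (EReal.coe_lt_coe_iff.1 (hτb ⟨ht.1, ht.2.trans_lt hM⟩)).le⟩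

/-! ### The comparison argument -/

section Comparison

variable {N : ℕ} {Ω : Set (EuclideanSpace ℝ (Fin N))}

lemma notMem_closure_of_boundaryDist_pos {x : EuclideanSpace ℝ (Fin N)} (hx : x ∉ Ω)
    (hd : 0 < boundaryDist Ω x) : x ∉ closure Ω := fun h => by
  have hfr : x ∈ frontier Ω := ⟨h, fun h' => hx (interior_subset h')⟩
  exact hd.ne' (Metric.infDist_zero_of_mem hfr)

lemma isOpen_exteriorCollar (s : ℝ) : IsOpen (exteriorCollar Ω s) := by
  have h1 : IsOpen {x | x ∉ closure Ω} := isClosed_closure.isOpen_compl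
  exact h1.inter ((isOpen_lt continuous_const continuous_boundaryDist).inter
    (isOpen_lt continuous_boundaryDist continuous_const))

/-- The viscosity form of `-Δ (W ∘ δ_Ω) ≤ -W'' + (N - 1) / (ρ - δ_Ω) W'` for increasing `W` at a
point on the radius of an exterior ball: if `u - W (δ_Ω) + H` has a local minimum there, then
`Δ u + Δ H` is bounded below by the Laplacian of `W` composed with the distance to the sphere. That
distance lies below `δ_Ω`, with equality at the point, so it can replace `δ_Ω` at the minimum. -/
lemma laplacian_ge_of_isLocalMin_sub_comp_boundaryDist (hfr : (frontier Ω).Nonempty)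
    {u H : EuclideanSpace ℝ (Fin N) → ℝ} {W W₁ W₂ : ℝ → ℝ} {R ρ : ℝ}
    {x z : EuclideanSpace ℝ (Fin N)}
    (hu : ContDiffAt ℝ 2 u x) (hH : ContDiffAt ℝ 2 H x) (hW : ContDiffOn ℝ 2 W (Set.Ioi 0))
    (hW₁ : ∀ r, 0 < r → HasDerivAt W (W₁ r) r) (hW₂ : ∀ r, 0 < r → HasDerivAt W₁ (W₂ r) r)
    (hmono : MonotoneOn W (Set.Ioc 0 R)) (hz : Metric.ball z ρ ⊆ Ωᶜ) (hxz : x ≠ z)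
    (hxd : dist x z = ρ - boundaryDist Ω x) (hδ : 0 < boundaryDist Ω x)
    (hδR : boundaryDist Ω x < R)
    (hmin : IsLocalMin (fun y => u y - W (boundaryDist Ω y) + H y) x) :
    W₂ (boundaryDist Ω x) - (N - 1) / (ρ - boundaryDist Ω x) * W₁ (boundaryDist Ω x) ≤
      Laplacian.laplacian u x + Laplacian.laplacian H x := by
  have hd : ρ - ‖x - z‖ = boundaryDist Ω x := by
    rw [← dist_eq_norm, hxd]
    ring
  have hWx : ContDiffAt ℝ 2 W (ρ - ‖x - z‖) := by
    rw [hd]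
    exact hW.contDiffAt (Ioi_mem_nhds hδ)
  have hWd := contDiffAt_comp_sub_norm hxz hWx
  have hcont : Filter.Tendsto (fun y => ρ - ‖y - z‖) (𝓝 x) (𝓝 (boundaryDist Ω x)) := by
    have h : Continuous fun y : EuclideanSpace ℝ (Fin N) => ρ - ‖y - z‖ := by fun_prop
    rw [← hd]
    exact h.tendsto x
  have hmin' : IsLocalMin (fun y => u y - W (ρ - ‖y - z‖) + H y) x := by
    filter_upwards [hmin, hcont.eventually (lt_mem_nhds hδ),
      (continuous_boundaryDist (Ω := Ω)).continuousAt.eventually (gt_mem_nhds hδR)]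
      with y hy hy0 hyR
    have hle : ρ - ‖y - z‖ ≤ boundaryDist Ω y := by
      rw [← dist_eq_norm]
      exact sub_dist_le_boundaryDist hfr hz
    have := hmono ⟨hy0, hle.trans hyR.le⟩ ⟨hy0.trans_le hle, hyR.le⟩ hle
    rw [hd]
    linarith
  have hlap := hmin'.laplacian_nonneg ((hu.sub hWd).add hH)
  have hL := laplacian_comp_sub_norm (W₂ := W₂) hxz hWx
    (by
      rw [hd]
      filter_upwards [lt_mem_nhds hδ] with r hr using hW₁ r hr)
    (by
      rw [hd]
      exact hW₂ _ hδ)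
  have h1 := ContDiffAt.laplacian_add (f₁ := u - fun y => W (ρ - ‖y - z‖)) (hu.sub hWd) hH
  have h2 := hu.laplacian_sub hWd
  rw [hd, finrank_euclideanSpace_fin, ← dist_eq_norm, hxd] at hL
  change 0 ≤ Laplacian.laplacian ((u - fun y => W (ρ - ‖y - z‖)) + H) x at hlap
  rw [h1, h2, hL] at hlap
  linarith

end Comparison

theorem mainTheorem6 (φ f : ℝ → ℝ)
    (hφ_cont : ContinuousOn φ (Set.Ioi 0)) (hφ_nonneg : ∀ r : ℝ, 0 < r → 0 ≤ φ r)
    (hf_cont : ContinuousOn f (Set.Ioi 0)) (hf_pos : ∀ t : ℝ, 0 < t → 0 < f t)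
    (hf_liminf : 0 < Filter.liminf (fun t : ℝ => (f t : EReal)) (𝓝[>] (0 : ℝ)))
    (hφ_int : ∫⁻ r in Set.Ioc (0 : ℝ) 1, ENNReal.ofReal (r * φ r) = ⊤)
    (N : ℕ) (hN : 2 ≤ N) (Ω : Set (EuclideanSpace ℝ (Fin N))) (hΩ : IsBoundedC2Domain Ω)
    (r₀ : ℝ) (hr₀ : 0 < r₀) :
    ¬ ∃ u : EuclideanSpace ℝ (Fin N) → ℝ,
      IsC2PositiveSolution φ f Ω (exteriorCollar Ω (2 * r₀)) u := by
  rintro ⟨u, hu⟩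
  have hΩne := hΩ.isConnected.nonempty
  have : Nonempty (Fin N) := ⟨⟨0, by lia⟩⟩
  have hΩuniv : Ω ≠ Set.univ := fun h =>
    NormedSpace.unbounded_univ ℝ (EuclideanSpace ℝ (Fin N)) (h ▸ hΩ.isBounded)
  obtain ⟨p, hp, H, hHC, hHp, hHΩ, hHR⟩ := exists_superharmonic_barrier hΩ.isOpen hΩne hΩuniv
    (by rw [finrank_euclideanSpace_fin]; lia)
  have hfr : (frontier Ω).Nonempty := ⟨p, hp⟩
  obtain ⟨g, hg, hgp, hloc⟩ := hΩ.hasC2Boundary p hp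
  obtain ⟨ρ, hρ, η, hη, hext⟩ := exists_uniform_exterior_ball hΩ.isOpen hg hgp hloc
  -- The comparison takes place within distance `R` of `p`.
  set R : ℝ := min r₀ (min (ρ / 2) (η / 4)) with hR
  have hR0 : 0 < R := by positivity
  have hRr : R ≤ r₀ := min_le_left _ _
  have hRρ : R ≤ ρ / 2 := (min_le_right _ _).trans (min_le_left _ _)
  have hRη : R ≤ η / 4 := (min_le_right _ _).trans (min_le_right _ _)
  obtain ⟨m, hm0, hHm⟩ := hHR R hR0
  have hcollar : ∀ x ∉ Ω, dist x p ≤ R → 0 < boundaryDist Ω x →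
      x ∈ exteriorCollar Ω (2 * r₀) := fun x hx hxR hx0 =>
    ⟨notMem_closure_of_boundaryDist_pos hx hx0, hx0,
      (boundaryDist_le_dist hp).trans_lt (by linarith)⟩
  -- A base point, outside `Ω` and so close to `p` that `H` is small there.
  obtain ⟨q, hqΩ, hqp, hqδ, hqH⟩ : ∃ q ∉ Ω, dist q p < R ∧ 0 < boundaryDist Ω q ∧
      H q < m / 4 := by
    obtain ⟨n, hn, hball, -⟩ := hext p hp (by simpa using hη)
    obtain ⟨τ, hτ, hτH⟩ := Metric.eventually_nhds_iff.1
      (hHC.continuous.continuousAt.eventually_lt_const (show H p < m / 4 by rw [hHp]; positivity))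
    set t := min τ R / 2 with ht
    have ht0 : 0 < t := by positivity
    have htτ : t < τ := by linarith [min_le_left τ R, ht, lt_min hτ hR0]
    have htR : t < R := by linarith [min_le_right τ R, ht, lt_min hτ hR0]
    have hd : dist (p + t • n) p = t := by
      rw [dist_eq_norm, add_sub_cancel_left, norm_smul, hn, mul_one, Real.norm_of_nonneg ht0.le]
    have hdz : dist (p + t • n) (p + ρ • n) = ρ - t := by
      rw [dist_eq_norm, add_sub_add_left_eq_sub, ← sub_smul, norm_smul, hn, mul_one, norm_sub_rev,
        Real.norm_of_nonneg (by linarith)]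
    refine ⟨p + t • n, hball (by rw [Metric.mem_ball, hdz]; linarith), hd.trans_lt htR, ?_,
      hτH (hd.trans_lt htτ)⟩
    have := sub_dist_le_boundaryDist hfr (x := p + t • n) hball
    linarith
  set M : ℝ := 4 * u q with hM
  have huq : 0 < u q := hu.pos q (hcollar q hqΩ hqp.le hqδ)
  have hM0 : 0 < M := by positivity
  set A : ℝ := M / m with hA
  have hA0 : 0 < A := div_pos hM0 hm0
  have hAm : A * m = M := div_mul_cancel₀ _ hm0.ne'
  obtain ⟨c, hc, hcf⟩ := exists_pos_le_of_liminf_pos hf_cont hf_pos hf_liminf M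
  obtain ⟨ε, W, W₁, W₂, hε, hεq, hWC, hW₁, hW₂, hWε, hWmono, hWR, hWq, hW₁nn, hWineq⟩ :=
    exists_barrier hφ_cont hφ_nonneg hφ_int (K := 2 * N / ρ) (by positivity) hqδ
      ((boundaryDist_le_dist hp).trans hqp.le) hc hM0
  set F : EuclideanSpace ℝ (Fin N) → ℝ :=
    fun x => u x - W (boundaryDist Ω x) + A * H x
  set C : Set (EuclideanSpace ℝ (Fin N)) :=
    Ωᶜ ∩ (Metric.closedBall p R ∩ {x | ε ≤ boundaryDist Ω x})
  have hCc : IsCompact C := by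
    refine ((isCompact_closedBall p R).inter_right
      (isClosed_le continuous_const continuous_boundaryDist)).inter_left ?_
    exact hΩ.isOpen.isClosed_compl
  have hCS : ∀ x ∈ C, x ∈ exteriorCollar Ω (2 * r₀) := fun x hx =>
    hcollar x hx.1 hx.2.1 (hε.trans_le hx.2.2)
  have hFC : ContinuousOn F C := by
    refine ((hu.contDiffOn.continuousOn.mono hCS).sub ?_).add
      (hHC.continuous.const_smul A).continuousOn
    exact hWC.continuousOn.comp continuous_boundaryDist.continuousOn
      fun x hx => hε.trans_le hx.2.2
  have hqC : q ∈ C := ⟨hqΩ, hqp.le, hεq.le⟩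
  obtain ⟨x, hxC, hxmin⟩ := hCc.exists_isMinOn ⟨q, hqC⟩ hFC
  have hFx : F x < 0 := by
    refine (hxmin hqC).trans_lt ?_
    have h1 : A * H q < A * (m / 4) := mul_lt_mul_of_pos_left hqH hA0
    have h2 : F q = u q - W (boundaryDist Ω q) + A * H q := rfl
    linarith
  have hxΩ : x ∉ Ω := hxC.1
  have hxδ0 : 0 < boundaryDist Ω x := hε.trans_le hxC.2.2
  have hux : 0 < u x := hu.pos x (hCS x hxC)
  have hAHx : 0 ≤ A * H x := mul_nonneg hA0.le (hHΩ x hxΩ).1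
  have hFx' : u x - W (boundaryDist Ω x) + A * H x < 0 := hFx
  have hxδR' : boundaryDist Ω x ≤ R := (boundaryDist_le_dist hp).trans hxC.2.1
  have hWx : W (boundaryDist Ω x) ≤ M := hWR ▸ hWmono ⟨hxδ0, hxδR'⟩ ⟨hR0, le_rfl⟩ hxδR'
  -- The minimum is negative, so it is attained in the interior of `C`.
  have hxε : ε < boundaryDist Ω x := by
    refine lt_of_le_of_ne hxC.2.2 fun h => ?_
    rw [← h, hWε] at hFx'
    linarith
  have hxR : dist x p < R := by
    refine lt_of_le_of_ne hxC.2.1 fun h => ?_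
    have h1 : m ≤ H x := hHm x hxΩ h
    have h2 : A * m ≤ A * H x := mul_le_mul_of_nonneg_left h1 hA0.le
    linarith
  have hxδR : boundaryDist Ω x < R := (boundaryDist_le_dist hp).trans_lt hxR
  have hxcl : x ∉ closure Ω := notMem_closure_of_boundaryDist_pos hxΩ hxδ0
  have hCn : C ∈ 𝓝 x := by
    filter_upwards [isClosed_closure.isOpen_compl.mem_nhds hxcl, Metric.isOpen_ball.mem_nhds hxR,
      continuous_boundaryDist.continuousAt.eventually (lt_mem_nhds hxε)] with y h1 h2 h3
    exact ⟨fun h => h1 (subset_closure h), Metric.ball_subset_closedBall h2, le_of_lt h3⟩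
  have hloc_min : IsLocalMin F x := hxmin.isLocalMin hCn
  -- The exterior ball at the boundary point nearest to `x` has `x` on its radius.
  obtain ⟨y, hy, hxy, hxball⟩ := exists_boundaryDist_eq_dist hΩne hxΩ
  have hyp : dist y p < η := by
    linarith [dist_triangle_left y p x]
  obtain ⟨n, hn, hball, hray⟩ := hext y hy hyp
  have hxn := hray x (dist_pos.1 (hxy ▸ hxδ0)) hxball
  rw [← hxy] at hxn
  have hdist : dist x (y + ρ • n) = ρ - boundaryDist Ω x := by
    conv_lhs => rw [hxn]
    rw [dist_eq_norm, add_sub_add_left_eq_sub, ← sub_smul, norm_smul, hn, mul_one, norm_sub_rev,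
      Real.norm_of_nonneg (by linarith)]
  have hlap := laplacian_ge_of_isLocalMin_sub_comp_boundaryDist (H := fun y => A * H y) hfr
    (hu.contDiffOn.contDiffAt ((isOpen_exteriorCollar _).mem_nhds (hCS x hxC)))
    (contDiffAt_const.mul hHC.contDiffAt) hWC hW₁ hW₂ hWmono hball
    (dist_pos.1 (by rw [hdist]; linarith)) hdist hxδ0 hxδR hloc_min
  have hlapH : Laplacian.laplacian (fun y => A * H y) x = A * Laplacian.laplacian H x :=
    InnerProductSpace.laplacian_smul A hHC.contDiffAt
  rw [hlapH] at hlap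
  have h1 := hu.ineq x (hCS x hxC)
  have h2 : φ (boundaryDist Ω x) * c ≤ φ (boundaryDist Ω x) * f (u x) :=
    mul_le_mul_of_nonneg_left (hcf _ ⟨hux, by linarith⟩) (hφ_nonneg _ hxδ0)
  have h3 := hWineq _ ⟨hxδ0, hxδR'⟩
  have h4 : A * Laplacian.laplacian H x < 0 := mul_neg_of_pos_of_neg hA0 (hHΩ x hxΩ).2
  -- The drift constant: the radius of the sphere through `x` is at least `ρ / 2`.
  have h5 : ((N : ℝ) - 1) / (ρ - boundaryDist Ω x) ≤ 2 * N / ρ := by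
    have h : ((N : ℝ) - 1) / (ρ - boundaryDist Ω x) ≤ N / (ρ / 2) :=
      div_le_div₀ (by positivity) (by linarith) (by positivity) (by linarith)
    refine h.trans_eq ?_
    field_simp
  have h6 := mul_le_mul_of_nonneg_right h5 (hW₁nn _ ⟨hxδ0, hxδR'⟩)
  linarith
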